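/- Let $d\ge 0$, $\mu\ge 1$, let $\xi^{(1)},\dots,\xi^{(\mu)}\in\mathbb{R}^d$ be distinct points and let $\Delta^{(1)},\dots,\Delta^{(\mu)}\subset\mathbb{N}_0^d$ be finite nonempty lower sets (downward closed for the product order). An *ideal projector* is an idempotent linear operator of finite rank on $\mathbb{R}[x]=\mathbb{R}[x_1,\dots,x_d]$ whose kernel is an ideal; for such a $P$ let $\mathrm{ran}\,P'=\{\lambda\in\mathbb{R}[x]' : \ker P\subset\ker\lambda\}$ be the range of its dual projector, and let $\mathrm{ran}_{lex}P$ be the span of the monomials that are not divisible by the leading monomial of any nonzero $f\in\ker P$ (the Gröbner éscalier of $\ker P$), with respect to the lexicographic order with $x_1\succ x_2\succ\dots\succ x_d$. A *Lagrange projector* is an ideal projector whose kernel is the vanishing ideal of a finite nonempty subset of $\mathbb{R}^d$. Write $\delta_\xi$ for evaluation at $\xi$ and $D^\alpha=\partial^{\alpha_1+\dots+\alpha_d}/\partial x_1^{\alpha_1}\cdots\partial x_d^{\alpha_d}$. Define $\eta\in[0,\infty]$ from the data as follows. Let $\Omega\subset(\mathbb{R}\times\mathbb{N}_0)^d$ be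 the set (algebraic multiset) of all $((\xi^{(k)}_1,\alpha_1),\dots,(\xi^{(k)}_d,\alpha_d))$ with $1\le k\le\mu$ and $\alpha\in\Delta^{(k)}$. Let $T(\Omega)$ be its rooted tree with $d$ levels: the root has no label, each $\omega\in\Omega$ gives a path from the root to a leaf whose successive nodes are labelled $\omega_d,\omega_{d-1},\dots,\omega_1$, and the paths of two elements coincide until level $k$ exactly when their last $k$ coordinates agree. For a finite set $L\subset\mathbb{R}\times\mathbb{N}_0$ put $$m(L)=\min\left\{\frac{|s-s'|}{|a-a'|} : (s,a),(s',a')\in L,\ s\ne s',\ a\ne a'\right\},\qquad \min\emptyset=\infty .$$ Let $L_1$ be the set of labels of the first-level nodes. Start with $\eta=\infty$ if $L_1$ has exactly one element, or if all elements of $L_1$ have the same first coordinate, or if all have the same second coordinate; otherwise start with $\eta=m(L_1)$. Then for $k=2,\dots,d$ and for every set $L$ with at least two elements that is the set of labels of the $k$-th level nodes having some common parent, replace $\eta$ by $\min(\eta,m(L))$. The final value is $\eta$. Let $P$ be the ideal projector of type partial derivative with $$\mathrm{ran}\,P'=\mathrm{Span}_{\mathbb{R}}\{\delta_{\xi^{(k)}}\circ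 D^\alpha : \alpha\in\Delta^{(k)},\ 1\le k\le\mu\}$$ and with range $\mathrm{ran}\,P=\mathrm{ran}_{lex}P$. For every real $h$ with $0<|h|<\eta$ let $P_h$ be the $h$-perturbed Lagrange projector of $P$, that is, the Lagrange projector with $$\mathrm{ran}\,P_h'=\mathrm{Span}_{\mathbb{R}}\{\delta_{\xi^{(k)}+h\alpha} : \alpha\in\Delta^{(k)},\ 1\le k\le\mu\},$$ whose range is $\mathrm{ran}\,P_h=\mathrm{ran}_{lex}P_h$. Then $\eta>0$; $\mathrm{ran}\,P_h=\mathrm{ran}\,P$ for all $0<|h|<\eta$; and $P_h$ converges pointwise to $P$ as $h\to 0$, i.e. for every $q\in\mathbb{R}[x]$ each coefficient of $P_hq$ tends to the corresponding coefficient of $Pq$. -/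

import Mathlib

open scoped ENNReal Topology

noncomputable section

namespace IdealProj

variable {d μ : ℕ}

/-- Linear operators on the polynomial ring `ℝ[x₁, …, x_d]`. -/
abbrev PolyOp (d : ℕ) : Type := MvPolynomial (Fin d) ℝ →ₗ[ℝ] MvPolynomial (Fin d) ℝ

/-- A finite-dimensional ideal projector: an idempotent linear operator of finite rank on the
polynomial ring whose kernel is an ideal. -/
structure IsIdealProjector (P : PolyOp d) : Prop where
  idem : P ∘ₗ P = P
  finiteDim : FiniteDimensional ℝ (LinearMap.range P)
  ker_ideal : ∃ I : Ideal (MvPolynomial (Fin d) ℝ), LinearMap.ker P = I.restrictScalars ℝ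

/-- A Lagrange projector: an ideal projector whose kernel is the vanishing ideal of a finite
nonempty set of points. -/
structure IsLagrangeProjector (P : PolyOp d) : Prop where
  isIdealProjector : IsIdealProjector P
  ker_eq : ∃ Ξ : Finset (Fin d → ℝ), Ξ.Nonempty ∧
    LinearMap.ker P =
      (MvPolynomial.vanishingIdeal ℝ (Ξ : Set (Fin d → ℝ))).restrictScalars ℝ

/-- The interpolation conditions matched by `P`: the range of the dual projector `P'`. -/
def ranDual (P : PolyOp d) : Submodule ℝ (Module.Dual ℝ (MvPolynomial (Fin d) ℝ)) :=
  LinearMap.range P.dualMap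

/-- The evaluation functional `δ_ξ`. -/
def evalAt (ξ : Fin d → ℝ) : Module.Dual ℝ (MvPolynomial (Fin d) ℝ) :=
  (MvPolynomial.aeval ξ : MvPolynomial (Fin d) ℝ →ₐ[ℝ] ℝ).toLinearMap

/-- The differential operator `D^α = ∂₁^{α₁} ∘ ⋯ ∘ ∂_d^{α_d}`. -/
def diffOp (α : Fin d → ℕ) : PolyOp d :=
  (List.ofFn fun i : Fin d =>
    ((MvPolynomial.pderiv i : Derivation ℝ (MvPolynomial (Fin d) ℝ) _).toLinearMap :
      Module.End ℝ (MvPolynomial (Fin d) ℝ)) ^ α i).prod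

/-- Lower sets are finite, nonempty and downward closed for the product order. -/
def IsLower (Δ : Finset (Fin d → ℕ)) : Prop :=
  Δ.Nonempty ∧ IsLowerSet (Δ : Set (Fin d → ℕ))

/-- `P` is an ideal projector of type partial derivative, with interpolation conditions
`δ_{ξ k} ∘ D^α`, `α ∈ Δ k`. -/
structure IsPartialDerivativeType (ξ : Fin μ → Fin d → ℝ) (Δ : Fin μ → Finset (Fin d → ℕ))
    (P : PolyOp d) : Prop where
  isIdealProjector : IsIdealProjector P
  ranDual_eq : ranDual P =
    Submodule.span ℝ {l | ∃ k, ∃ α ∈ Δ k, l = evalAt (ξ k) ∘ₗ diffOp α}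

/-- `Q` is an `h`-perturbed Lagrange projector: it is a Lagrange projector with interpolation
conditions `δ_{ξ k + h α}`, `α ∈ Δ k`. -/
structure IsPerturbedLagrange (ξ : Fin μ → Fin d → ℝ) (Δ : Fin μ → Finset (Fin d → ℕ))
    (h : ℝ) (Q : PolyOp d) : Prop where
  isLagrangeProjector : IsLagrangeProjector Q
  ranDual_eq : ranDual Q =
    Submodule.span ℝ {l | ∃ k, ∃ α ∈ Δ k, l = evalAt (fun i => ξ k i + h * (α i : ℝ))}

/-- Exponents of the Gröbner éscalier of a set `K` of polynomials with respect to the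
lexicographic order `x₁ ≻ x₂ ≻ ⋯ ≻ x_d`: the monomials that are divisible by the leading
monomial of no nonzero element of `K`. -/
def lexEscalier (K : Set (MvPolynomial (Fin d) ℝ)) : Set (Fin d →₀ ℕ) :=
  {a | ∀ f ∈ K, f ≠ 0 → ¬ MonomialOrder.lex.degree f ≤ a}

/-- `ran_lex P`: the span of the lexicographic Gröbner éscalier of the kernel of `P`. -/
def lexRange (P : PolyOp d) : Submodule ℝ (MvPolynomial (Fin d) ℝ) :=
  Submodule.span ℝ
    ((fun a => MvPolynomial.monomial a (1 : ℝ)) ''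
      lexEscalier (LinearMap.ker P : Set (MvPolynomial (Fin d) ℝ)))

/-- The algebraic multiset `Ω ⊆ (ℝ × ℕ)^d`. -/
def algMultiset (ξ : Fin μ → Fin d → ℝ) (Δ : Fin μ → Finset (Fin d → ℕ)) :
    Set (Fin d → ℝ × ℕ) :=
  {ω | ∃ k, ∃ α ∈ Δ k, ω = fun i => (ξ k i, α i)}

/-- The rooted tree of a set of points. A node is given by the list of the labels on the path
from the root to it; its level is the length of this list, the root is `[]`, and the parent of
`v ++ [a]` is `v`. The labels along the path belonging to a point are its `d`-th coordinate,
its `(d-1)`-st coordinate, and so on; paths of two points with the same `k` ending coordinates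
coincide until level `k`. -/
def rootedTree {A : Type*} (Ω : Set (Fin d → A)) : Set (List A) :=
  {v | ∃ ω ∈ Ω, v <+: (List.ofFn ω).reverse}

/-- The set of labels of the children of the node `v`. -/
def childLabels {A : Type*} (T : Set (List A)) (v : List A) : Set A :=
  {a | v ++ [a] ∈ T}

/-- The minimum of `|ξ - ξ'| / |α - α'|` over all pairs `(ξ, α), (ξ', α') ∈ L` with `ξ ≠ ξ'` and
`α ≠ α'` (finitely many for the sets `L` in use); it is `∞` if there is no such pair. -/
def minRatio (L : Set (ℝ × ℕ)) : ℝ≥0∞ :=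
  sInf {r | ∃ p ∈ L, ∃ q ∈ L, p.1 ≠ q.1 ∧ p.2 ≠ q.2 ∧
    r = ENNReal.ofReal (|p.1 - q.1| / |(p.2 : ℝ) - (q.2 : ℝ)|)}

open Classical in
/-- The value of `η` after the first level of the tree has been treated. -/
def etaFirst (L : Set (ℝ × ℕ)) : ℝ≥0∞ :=
  if L.encard = 1 then ⊤
  else if (∀ p ∈ L, ∀ q ∈ L, p.1 = q.1) ∨ (∀ p ∈ L, ∀ q ∈ L, p.2 = q.2) then ⊤
  else minRatio L

/-- The output `η` of the algorithm on the points `ξ` and the lower sets `Δ`: the first level is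
treated by `etaFirst`; then, for `k = 2, …, d` and each set of at least two labels of `k`-th level
nodes with a common parent, `η` is replaced by the minimum of `η` and the value `minRatio`. -/
def eta (ξ : Fin μ → Fin d → ℝ) (Δ : Fin μ → Finset (Fin d → ℕ)) : ℝ≥0∞ :=
  let T := rootedTree (algMultiset ξ Δ)
  min (etaFirst (childLabels T []))
    (⨅ k ∈ Finset.Icc 2 d, ⨅ v ∈ {v ∈ T | v.length + 1 = k ∧ 2 ≤ (childLabels T v).encard},
      minRatio (childLabels T v))

end IdealProj

end

/-!
The projectors `P` and `P_h` have the same lexicographic éscalier because it is determined by the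
tree of the algebraic multiset `Ω`, and it then only remains to pass to the limit in a linear
system.

*The éscalier.* A label `(s, a)` is read as a univariate functional: `p ↦ p⁽ᵃ⁾(s)` for `P` and
`p ↦ p(s + h a)` for `P_h`. In both cases the interpolation conditions are the tensor products
`prodFunctional` of these functionals along the elements of `Ω`. The set `lexExponents Ω` is defined
by recursion on the dimension from fiber cardinalities alone; it has as many elements as `Ω`
(`card_lexExponents`). If a nonzero `f` of degree `w` in `x₁` is annihilated by all conditions, then
over each tail with more than `w` extensions in `Ω` univariate unisolvence shows that the condition
at this tail annihilates the leading coefficient of `f` in `x₁`. By induction the leading exponent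
of `f` is not in `lexExponents Ω` (`lex_degree_notMem_lexExponents`), so this set is contained in
the éscalier. The éscalier is independent modulo the kernel, whose codimension is at most the
cardinality of `Ω`, whence equality (`lexEscalier_eq_lexExponents`). Unisolvence holds for
derivatives because the fibers inherit downward closedness from the lower sets
(`fiberUnisolvent_derivValue`), and for the perturbed evaluations because `0 < |h| < η` makes
`(s, a) ↦ s + h a` injective on the children of each node of the tree (`eq_of_shiftNode_eq`).

*Convergence.* As the `Δ k` are lower sets, the conditions of `P_h` span divided differences that
tend to `δ_ξ ∘ D^α` (`tendsto_prodFunctional_diffValue`). The coefficients of `P_h q` in the common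
monomial basis of the ranges thus solve a linear system whose matrix and right-hand side converge to
those for `P q`. The limit matrix is injective since the range and the kernel of `P` meet trivially,
so the solutions converge (`tendsto_of_mulVec_eq`).
-/

namespace IdealProj

/-! ### Lexicographic exponents of a finite set of label vectors -/

section LexExponents

variable {A : Type*} [DecidableEq A]

/-- The first coordinates of the elements of `Ω` with the given tail `t`. -/
def fiber {d : ℕ} (Ω : Finset (Fin (d + 1) → A)) (t : Fin d → A) : Finset A :=
  (Ω.filter fun ω => Fin.tail ω = t).image fun ω => ω 0

/-- The tails that extend to more than `w` elements of `Ω`. -/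
def heavyTails {d : ℕ} (Ω : Finset (Fin (d + 1) → A)) (w : ℕ) : Finset (Fin d → A) :=
  (Ω.image Fin.tail).filter fun t => w < (fiber Ω t).card

/-- The combinatorial lexicographic éscalier of a finite set of label vectors: an exponent with
first entry `w` and tail `a` belongs to it when `a` belongs to that of the tails with more than `w`
extensions. It depends on the tree of `Ω` only, not on the meaning of the labels. -/
noncomputable def lexExponents : {d : ℕ} → Finset (Fin d → A) → Finset (Fin d →₀ ℕ)
  | 0, Ω => Ω.image fun _ => 0
  | _ + 1, Ω => (Finset.range Ω.card).biUnion fun w =>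
      (lexExponents (heavyTails Ω w)).image (Finsupp.cons w)

lemma mem_fiber {d : ℕ} {Ω : Finset (Fin (d + 1) → A)} {t : Fin d → A} {x : A} :
    x ∈ fiber Ω t ↔ (Fin.cons x t : Fin (d + 1) → A) ∈ Ω := by
  simp only [fiber, Finset.mem_image, Finset.mem_filter]
  constructor
  · rintro ⟨ω, ⟨hω, rfl⟩, rfl⟩
    rwa [Fin.cons_self_tail]
  · intro h
    exact ⟨_, ⟨h, Fin.tail_cons _ _⟩, Fin.cons_zero _ _⟩

lemma mem_heavyTails {d : ℕ} {Ω : Finset (Fin (d + 1) → A)} {t : Fin d → A} {w : ℕ} :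
    t ∈ heavyTails Ω w ↔ w < (fiber Ω t).card := by
  simp only [heavyTails, Finset.mem_filter, Finset.mem_image, and_iff_right_iff_imp]
  intro h
  obtain ⟨x, hx⟩ := Finset.card_pos.mp (Nat.zero_lt_of_lt h)
  exact ⟨_, mem_fiber.mp hx, Fin.tail_cons _ _⟩

lemma exists_cons_mem_of_mem_heavyTails {d : ℕ} {Ω : Finset (Fin (d + 1) → A)} {t : Fin d → A}
    {w : ℕ} (h : t ∈ heavyTails Ω w) : ∃ x, (Fin.cons x t : Fin (d + 1) → A) ∈ Ω := by
  obtain ⟨x, hx⟩ := Finset.card_pos.mp (Nat.zero_lt_of_lt (mem_heavyTails.mp h))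
  exact ⟨x, mem_fiber.mp hx⟩

lemma card_fiber {d : ℕ} (Ω : Finset (Fin (d + 1) → A)) (t : Fin d → A) :
    (fiber Ω t).card = (Ω.filter fun ω => Fin.tail ω = t).card := by
  refine Finset.card_image_of_injOn fun ω hω ω' hω' h => ?_
  simp only [Finset.coe_filter, Set.mem_ofPred_eq] at hω hω'
  rw [← Fin.cons_self_tail ω, ← Fin.cons_self_tail ω', hω.2, hω'.2]
  exact congrArg (fun x => (Fin.cons x t : Fin (d + 1) → A)) h

lemma tail_mem_lexExponents {d : ℕ} {Ω : Finset (Fin (d + 1) → A)} {w : ℕ} {a : Fin d →₀ ℕ}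
    (h : Finsupp.cons w a ∈ lexExponents Ω) : a ∈ lexExponents (heavyTails Ω w) := by
  simp only [lexExponents, Finset.mem_biUnion, Finset.mem_image] at h
  obtain ⟨w', -, a', ha', h⟩ := h
  obtain ⟨rfl, rfl⟩ := Finsupp.cons_injective2 h
  exact ha'

lemma card_lexExponents : ∀ {d : ℕ} (Ω : Finset (Fin d → A)), (lexExponents Ω).card = Ω.card
  | 0, Ω => Finset.card_image_of_injective _ (Function.injective_of_subsingleton _)
  | d + 1, Ω => by
    rw [lexExponents, Finset.card_biUnion]
    · calc ∑ w ∈ Finset.range Ω.card,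
            ((lexExponents (heavyTails Ω w)).image (Finsupp.cons w)).card
          = ∑ w ∈ Finset.range Ω.card, (heavyTails Ω w).card := by
            refine Finset.sum_congr rfl fun w _ => ?_
            rw [Finset.card_image_of_injective _ (Finsupp.cons_right_injective w),
              card_lexExponents]
        _ = ∑ t ∈ Ω.image Fin.tail, (fiber Ω t).card := by
            simp only [heavyTails, Finset.card_filter]
            rw [Finset.sum_comm]
            refine Finset.sum_congr rfl fun t _ => ?_
            rw [← Finset.card_filter]
            have : (Finset.range Ω.card).filter (fun w => w < (fiber Ω t).card)
                = Finset.range (fiber Ω t).card := by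
              ext w
              simp only [Finset.mem_filter, Finset.mem_range, and_iff_right_iff_imp]
              intro h
              refine h.trans_le ?_
              rw [card_fiber]
              exact Finset.card_filter_le _ _
            rw [this, Finset.card_range]
        _ = Ω.card := by
            simp only [card_fiber]
            exact (Finset.card_eq_sum_card_image Fin.tail Ω).symm
    · intro w _ w' _ hne
      simp only [Function.onFun, Finset.disjoint_left, Finset.mem_image, not_exists, not_and]
      rintro _ ⟨a, -, rfl⟩ b - hb
      exact hne (Finsupp.cons_injective2 hb).1.symm

end LexExponents

/-! ### Lexicographic degree and the first variable -/

lemma toLex_cons_le_of_lt {d : ℕ} {v w : ℕ} (a b : Fin d →₀ ℕ) (h : v < w) :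
    toLex (Finsupp.cons v a) ≤ toLex (Finsupp.cons w b) := by
  refine le_of_lt (Finsupp.Lex.lt_iff.mpr ⟨0, fun j hj => absurd hj (Fin.not_lt_zero j), ?_⟩)
  simpa using h

lemma toLex_cons_le_cons {d : ℕ} (w : ℕ) {a b : Fin d →₀ ℕ} (h : toLex a ≤ toLex b) :
    toLex (Finsupp.cons w a) ≤ toLex (Finsupp.cons w b) := by
  rcases h.lt_or_eq with h | h
  · obtain ⟨i, hi, hlt⟩ := Finsupp.Lex.lt_iff.mp h
    refine le_of_lt (Finsupp.Lex.lt_iff.mpr ⟨i.succ, fun j hj => ?_, by simpa using hlt⟩)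
    induction j using Fin.cases with
    | zero => simp
    | succ j => simpa using hi j (Fin.succ_lt_succ_iff.mp hj)
  · rw [toLex.injective h]

lemma lex_degree_eq_cons {d : ℕ} {f : MvPolynomial (Fin (d + 1)) ℝ} (hf : f ≠ 0) :
    MonomialOrder.lex.degree f =
      Finsupp.cons (MvPolynomial.finSuccEquiv ℝ d f).natDegree
        (MonomialOrder.lex.degree (MvPolynomial.finSuccEquiv ℝ d f).leadingCoeff) := by
  set F := MvPolynomial.finSuccEquiv ℝ d f with hF
  have hF0 : F ≠ 0 := by simpa [hF] using hf
  apply MonomialOrder.lex.toSyn.injective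
  apply le_antisymm
  · rw [MonomialOrder.degree_le_iff]
    intro b hb
    rw [MonomialOrder.lex_le_iff]
    rw [← Finsupp.cons_tail b, ← MvPolynomial.mem_support_coeff_finSuccEquiv] at hb
    rw [← Finsupp.cons_tail b]
    have hle : b 0 ≤ F.natDegree := by
      refine Polynomial.le_natDegree_of_ne_zero fun h => ?_
      rw [← hF, h] at hb
      simp at hb
    rcases hle.lt_or_eq with h | h
    · exact toLex_cons_le_of_lt _ _ h
    · rw [h]
      refine toLex_cons_le_cons _ (MonomialOrder.lex_le_iff.mp (MonomialOrder.lex.le_degree ?_))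
      rwa [h] at hb
  · apply MonomialOrder.le_degree
    rw [← MvPolynomial.mem_support_coeff_finSuccEquiv]
    exact MonomialOrder.degree_mem_support (Polynomial.leadingCoeff_ne_zero.mpr hF0)

/-! ### Tensor products of univariate functionals -/

/-- The tensor product of univariate functionals. The functional attached to a label `x` is given
by its values `c x n` at `X ^ n`. -/
noncomputable def prodFunctional {A : Type*} (c : A → ℕ → ℝ) {d : ℕ} (ω : Fin d → A) :
    Module.Dual ℝ (MvPolynomial (Fin d) ℝ) :=
  (MvPolynomial.basisMonomials (Fin d) ℝ).constr ℝ fun a => ∏ i, c (ω i) (a i)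

section ProdFunctional

variable {A : Type*} (c : A → ℕ → ℝ)

lemma prodFunctional_monomial {d : ℕ} (ω : Fin d → A) (a : Fin d →₀ ℕ) (r : ℝ) :
    prodFunctional c ω (MvPolynomial.monomial a r) = r * ∏ i, c (ω i) (a i) := by
  have : MvPolynomial.monomial a r = r • MvPolynomial.basisMonomials (Fin d) ℝ a := by
    simp [MvPolynomial.smul_monomial]
  rw [this, map_smul, prodFunctional, Module.Basis.constr_basis, smul_eq_mul]

lemma prodFunctional_apply {d : ℕ} (ω : Fin d → A) (f : MvPolynomial (Fin d) ℝ) :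
    prodFunctional c ω f = ∑ a ∈ f.support, f.coeff a * ∏ i, c (ω i) (a i) := by
  conv_lhs => rw [f.as_sum]
  rw [map_sum]
  exact Finset.sum_congr rfl fun a _ => prodFunctional_monomial c ω a _

/-- A functional that agrees with a tensor product on monomials is that tensor product. -/
lemma eq_prodFunctional {d : ℕ} {ω : Fin d → A} {l : Module.Dual ℝ (MvPolynomial (Fin d) ℝ)}
    (h : ∀ a : Fin d →₀ ℕ, l (MvPolynomial.monomial a 1) = ∏ i, c (ω i) (a i)) :
    l = prodFunctional c ω := by
  refine (MvPolynomial.basisMonomials (Fin d) ℝ).ext fun a => ?_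
  rw [MvPolynomial.coe_basisMonomials, h, prodFunctional_monomial, one_mul]

lemma prodFunctional_cons {d : ℕ} (x : A) (t : Fin d → A) (f : MvPolynomial (Fin (d + 1)) ℝ)
    {N : ℕ} (hN : (MvPolynomial.finSuccEquiv ℝ d f).natDegree < N) :
    prodFunctional c (Fin.cons x t : Fin (d + 1) → A) f = ∑ n ∈ Finset.range N,
      prodFunctional c t ((MvPolynomial.finSuccEquiv ℝ d f).coeff n) * c x n := by
  rw [← Polynomial.sum_over_range' _
    (f := fun n (g : MvPolynomial (Fin d) ℝ) => prodFunctional c t g * c x n)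
    (fun n => by simp) N hN]
  clear hN
  induction f using MvPolynomial.induction_on' with
  | monomial a r =>
    have : MvPolynomial.finSuccEquiv ℝ d (MvPolynomial.monomial a r) =
        Polynomial.monomial (a 0) (MvPolynomial.monomial a.tail r) := by
      ext n b
      rw [MvPolynomial.finSuccEquiv_coeff_coeff, Polynomial.coeff_monomial,
        MvPolynomial.coeff_monomial]
      obtain ⟨m, a, rfl⟩ : ∃ m a', a = Finsupp.cons m a' := ⟨_, _, (Finsupp.cons_tail a).symm⟩
      rw [Finsupp.cons_zero, Finsupp.tail_cons]
      by_cases h : m = n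
      · subst h
        simp [MvPolynomial.coeff_monomial, (Finsupp.cons_right_injective m).eq_iff]
      · rw [if_neg h, if_neg fun h' => h (Finsupp.cons_injective2 h').1, MvPolynomial.coeff_zero]
    rw [this, Polynomial.sum_monomial_index _ _ (by simp), prodFunctional_monomial,
      prodFunctional_monomial, Fin.prod_univ_succ]
    simp only [Fin.cons_zero, Fin.cons_succ, Finsupp.tail_apply]
    ring
  | add p q hp hq =>
    rw [map_add, map_add, hp, hq, Polynomial.sum_add_index]
    · simp
    · intros; simp [add_mul]

/-- The functionals attached to the labels in `L` are unisolvent on the univariate polynomials of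
degree less than the cardinality of `L`: the only such polynomial annihilated by all of them is
zero. -/
def Unisolvent (L : Finset A) : Prop :=
  ∀ b : ℕ → ℝ, (∀ x ∈ L, ∑ n ∈ Finset.range L.card, b n * c x n = 0) → ∀ n < L.card, b n = 0

variable [DecidableEq A]

/-- All fibers met in the recursive construction of `lexExponents Ω` are unisolvent. -/
def FiberUnisolvent : {d : ℕ} → Finset (Fin d → A) → Prop
  | 0, _ => True
  | _ + 1, Ω => (∀ t, Unisolvent c (fiber Ω t)) ∧ ∀ w, FiberUnisolvent (heavyTails Ω w)

/-- A nonzero polynomial annihilated by the functionals of `Ω` has its leading exponent outside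
`lexExponents Ω`: over a tail with more than `deg_{x₁} f` extensions, unisolvence kills the leading
coefficient of `f` in `x₁`, to which the same argument applies. -/
lemma lex_degree_notMem_lexExponents : ∀ {d : ℕ} {Ω : Finset (Fin d → A)},
    FiberUnisolvent c Ω → ∀ {f : MvPolynomial (Fin d) ℝ}, f ≠ 0 →
    (∀ ω ∈ Ω, prodFunctional c ω f = 0) → MonomialOrder.lex.degree f ∉ lexExponents Ω
  | 0, Ω, _, f, hf, h0, hmem => by
    obtain ⟨ω, hω, -⟩ := Finset.mem_image.mp hmem
    obtain ⟨r, rfl⟩ := MvPolynomial.C_surjective (Fin 0) f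
    have := h0 ω hω
    rw [MvPolynomial.C_apply, prodFunctional_monomial] at this
    simp only [Finset.univ_eq_empty, Finset.prod_empty, mul_one] at this
    simp [this] at hf
  | d + 1, Ω, hΩ, f, hf, h0, hmem => by
    rw [lex_degree_eq_cons hf] at hmem
    refine lex_degree_notMem_lexExponents (hΩ.2 _) (by simpa using hf) (fun t ht => ?_)
      (tail_mem_lexExponents hmem)
    rw [mem_heavyTails] at ht
    refine hΩ.1 t (fun n => prodFunctional c t ((MvPolynomial.finSuccEquiv ℝ d f).coeff n))
      (fun x hx => ?_) _ ht
    rw [← prodFunctional_cons c x t f ht]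
    exact h0 _ (mem_fiber.mp hx)

/-! ### The éscalier of the common kernel of the functionals -/

/-- The éscalier of an ideal of codimension at most `card Ω` contains `lexExponents Ω`, and its
monomials are linearly independent modulo the ideal, so counting gives equality. -/
theorem lexEscalier_eq_lexExponents {d : ℕ} {Ω : Finset (Fin d → A)} (hΩ : FiberUnisolvent c Ω)
    {I : Ideal (MvPolynomial (Fin d) ℝ)}
    (hI : ∀ f, f ∈ I ↔ ∀ ω ∈ Ω, prodFunctional c ω f = 0) :
    lexEscalier (I : Set (MvPolynomial (Fin d) ℝ)) = lexExponents Ω := by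
  have hsub : (lexExponents Ω : Set (Fin d →₀ ℕ)) ⊆ lexEscalier (I : Set _) := by
    intro a ha f hf hf0 hle
    have hmon : (MvPolynomial.monomial (a - MonomialOrder.lex.degree f) (1 : ℝ)) ≠ 0 := by simp
    have hdeg : MonomialOrder.lex.degree
        (MvPolynomial.monomial (a - MonomialOrder.lex.degree f) (1 : ℝ) * f) = a := by
      rw [MonomialOrder.degree_mul hmon hf0]
      classical
      rw [MonomialOrder.degree_monomial, if_neg one_ne_zero]
      exact tsub_add_cancel_of_le hle
    refine lex_degree_notMem_lexExponents c hΩ (mul_ne_zero hmon hf0)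
      ((hI _).mp (I.mul_mem_left _ hf)) ?_
    rwa [hdeg]
  -- The collocation functionals are injective on the span of the éscalier monomials.
  let Λ : MvPolynomial (Fin d) ℝ →ₗ[ℝ] (Ω → ℝ) := LinearMap.pi fun ω => prodFunctional c ω.1
  have hind : LinearIndependent ℝ fun a : lexEscalier (I : Set (MvPolynomial (Fin d) ℝ)) =>
      Λ (MvPolynomial.monomial a.1 1) := by
    rw [linearIndependent_iff']
    intro s g hg
    by_contra! hne
    obtain ⟨i, hi, hgi⟩ := hne
    set f : MvPolynomial (Fin d) ℝ := ∑ a ∈ s, g a • MvPolynomial.monomial a.1 1 with hf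
    have hcoeff : ∀ b, f.coeff b ≠ 0 → b ∈ lexEscalier (I : Set (MvPolynomial (Fin d) ℝ)) := by
      intro b hb
      rw [hf, MvPolynomial.coeff_sum] at hb
      obtain ⟨a, -, ha⟩ := Finset.exists_ne_zero_of_sum_ne_zero hb
      simp only [MvPolynomial.coeff_smul, MvPolynomial.coeff_monomial] at ha
      by_cases hab : a.1 = b
      · exact hab ▸ a.2
      · simp [hab] at ha
    have hf0 : f ≠ 0 := by
      intro h
      refine hgi ?_
      have := congrArg (MvPolynomial.coeff i.1) h
      rw [hf, MvPolynomial.coeff_sum, Finset.sum_eq_single i] at this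
      · simpa using this
      · intro b _ hb
        simp [MvPolynomial.coeff_monomial, Subtype.coe_injective.ne hb]
      · exact fun h => absurd hi h
    have hfI : f ∈ I := by
      refine (hI f).mpr fun ω hω => ?_
      have := congrFun hg ⟨ω, hω⟩
      simpa [hf, Λ] using this
    exact hcoeff _ (MonomialOrder.lex.coeff_degree_ne_zero_iff.mpr hf0) f hfI hf0 le_rfl
  have hfin := hind.finite
  have := Fintype.ofFinite (lexEscalier (I : Set (MvPolynomial (Fin d) ℝ)))
  have hcard := hind.fintype_card_le_finrank
  refine (Set.eq_of_subset_of_ncard_le hsub ?_ (Set.toFinite _)).symm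
  rw [Set.ncard_coe_finset, card_lexExponents, ← Nat.card_coe_set_eq, Nat.card_eq_fintype_card]
  simpa using hcard

end ProdFunctional

/-! ### Unisolvence for derivatives and for perturbed evaluations -/

/-- The value at `X ^ n` of the functional `p ↦ p⁽ᵃ⁾(s)` attached to the label `(s, a)`. -/
noncomputable def derivValue (x : ℝ × ℕ) (n : ℕ) : ℝ := n.descFactorial x.2 * x.1 ^ (n - x.2)

/-- The perturbed node `s + h a` of the label `(s, a)`. -/
def shiftNode (h : ℝ) (x : ℝ × ℕ) : ℝ := x.1 + h * x.2

/-- The value at `X ^ n` of the evaluation at the perturbed node of a label. -/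
def shiftValue (h : ℝ) (x : ℝ × ℕ) (n : ℕ) : ℝ := shiftNode h x ^ n

lemma unisolvent_of_polynomial {A : Type*} {c : A → ℕ → ℝ} {L : Finset A}
    (H : ∀ p : Polynomial ℝ, p ≠ 0 → p.natDegree < L.card →
      ∃ x ∈ L, ∑ n ∈ Finset.range L.card, p.coeff n * c x n ≠ 0) : Unisolvent c L := by
  intro b hb n hn
  set p : Polynomial ℝ := ∑ n ∈ Finset.range L.card, Polynomial.monomial n (b n) with hp
  have hcoeff : ∀ m, p.coeff m = if m < L.card then b m else 0 := by
    intro m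
    simp [hp, Polynomial.finsetSum_coeff, Polynomial.coeff_monomial]
  have h0 : p = 0 := by
    by_contra hne
    have hdeg : p.natDegree < L.card := by
      by_contra hlt
      exact hne (Polynomial.leadingCoeff_eq_zero.mp ((hcoeff _).trans (if_neg hlt)))
    obtain ⟨x, hx, hx0⟩ := H p hne hdeg
    refine hx0 ((Finset.sum_congr rfl fun m hm => ?_).trans (hb x hx))
    rw [hcoeff, if_pos (Finset.mem_range.mp hm)]
  have := hcoeff n
  rwa [h0, if_pos hn, Polynomial.coeff_zero, eq_comm] at this

lemma unisolvent_shiftValue {h : ℝ} {L : Finset (ℝ × ℕ)}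
    (hL : Set.InjOn (shiftNode h) (L : Set (ℝ × ℕ))) : Unisolvent (shiftValue h) L := by
  refine unisolvent_of_polynomial fun p hne hdeg => ?_
  by_contra! hp
  refine hne (Polynomial.eq_zero_of_degree_lt_of_eval_index_eq_zero L hL
    ((Polynomial.natDegree_lt_iff_degree_lt hne).mp hdeg) fun x hx => ?_)
  rw [p.as_sum_range' L.card hdeg, Polynomial.eval_finsetSum, ← hp x hx]
  simp [Polynomial.eval_monomial, shiftValue]

/-- Derivative conditions at finitely many nodes, of all orders up to some bound at each node, are
unisolvent: they bound the root multiplicities of a nonzero polynomial from below. -/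
lemma unisolvent_derivValue {L : Finset (ℝ × ℕ)}
    (hL : ∀ x ∈ L, ∀ b ≤ x.2, (x.1, b) ∈ L) : Unisolvent derivValue L := by
  refine unisolvent_of_polynomial fun p hne hdeg => ?_
  by_contra! hp
  have hroot : ∀ x ∈ L, (Polynomial.derivative^[x.2] p).IsRoot x.1 := by
    intro x hx
    rw [Polynomial.IsRoot.def, p.as_sum_range' L.card hdeg, Polynomial.iterate_derivative_sum,
      Polynomial.eval_finsetSum, ← hp x hx]
    refine Finset.sum_congr rfl fun m _ => ?_
    rw [← Polynomial.C_mul_X_pow_eq_monomial, Polynomial.iterate_derivative_C_mul,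
      Polynomial.iterate_derivative_X_pow_eq_natCast_mul]
    simp [derivValue]
  -- Every node is a root of multiplicity at least the number of labels above it.
  have hmult : ∀ s, (L.filter fun x => x.1 = s).card ≤ p.roots.count s := by
    intro s
    rw [Polynomial.count_roots]
    have hnot : ∀ x ∈ L, x.1 = s → x.2 < p.rootMultiplicity s := by
      rintro x hx rfl
      rw [Polynomial.lt_rootMultiplicity_iff_isRoot_iterate_derivative hne]
      exact fun m hm => hroot _ (hL x hx m hm)
    calc (L.filter fun x => x.1 = s).card
        ≤ (Finset.range (p.rootMultiplicity s)).card := by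
          refine Finset.card_le_card_of_injOn Prod.snd (fun x hx => ?_) fun x hx y hy hxy => ?_
          · simp only [Finset.coe_filter, Set.mem_ofPred_eq] at hx
            simpa using hnot x hx.1 hx.2
          · simp only [Finset.coe_filter, Set.mem_ofPred_eq] at hx hy
            exact Prod.ext (hx.2.trans hy.2.symm) hxy
      _ = p.rootMultiplicity s := Finset.card_range _
  have hcard : L.card ≤ p.roots.card := by
    rw [Finset.card_eq_sum_card_image Prod.fst L]
    calc ∑ s ∈ L.image Prod.fst, (L.filter fun x => x.1 = s).card
        ≤ ∑ s ∈ L.image Prod.fst, p.roots.count s := Finset.sum_le_sum fun s _ => hmult s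
      _ ≤ ∑ s ∈ p.roots.toFinset, p.roots.count s :=
          Finset.sum_le_sum_of_ne_zero fun s _ hs =>
            Multiset.mem_toFinset.mpr (Multiset.count_ne_zero.mp hs)
      _ = p.roots.card := Multiset.toFinset_sum_count_eq _
  exact absurd hdeg (hcard.trans (Polynomial.card_roots' p)).not_gt

/-- The hypothesis says that the perturbation separates the children of every node of the tree. -/
lemma fiberUnisolvent_shiftValue {h : ℝ} : ∀ {d : ℕ} {Ω : Finset (Fin d → ℝ × ℕ)},
    (∀ ω ∈ Ω, ∀ ω' ∈ Ω, ∀ i, (∀ j, i < j → ω j = ω' j) →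
      shiftNode h (ω i) = shiftNode h (ω' i) → ω i = ω' i) → FiberUnisolvent (shiftValue h) Ω
  | 0, _, _ => trivial
  | d + 1, Ω, hΩ => by
    refine ⟨fun t => unisolvent_shiftValue fun x hx y hy hxy => ?_,
      fun w => fiberUnisolvent_shiftValue fun t ht t' ht' i hij hi => ?_⟩
    · refine hΩ _ (mem_fiber.mp hx) _ (mem_fiber.mp hy) 0 (fun j hj => ?_) (by simpa using hxy)
      obtain ⟨j, rfl⟩ := Fin.exists_succ_eq.mpr hj.ne'
      simp
    · obtain ⟨x, hx⟩ := exists_cons_mem_of_mem_heavyTails ht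
      obtain ⟨x', hx'⟩ := exists_cons_mem_of_mem_heavyTails ht'
      refine hΩ _ hx _ hx' i.succ (fun j hj => ?_) (by simpa using hi)
      obtain ⟨j, rfl⟩ := Fin.exists_succ_eq.mpr (Fin.ne_zero_of_lt hj)
      simpa using hij j (Fin.succ_lt_succ_iff.mp hj)

lemma fiberUnisolvent_derivValue : ∀ {d : ℕ} {Ω : Finset (Fin d → ℝ × ℕ)},
    (∀ ω ∈ Ω, ∀ ω' : Fin d → ℝ × ℕ, (∀ i, (ω' i).1 = (ω i).1 ∧ (ω' i).2 ≤ (ω i).2) → ω' ∈ Ω) →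
      FiberUnisolvent derivValue Ω
  | 0, _, _ => trivial
  | d + 1, Ω, hΩ => by
    refine ⟨fun t => unisolvent_derivValue fun x hx b hb => ?_,
      fun w => fiberUnisolvent_derivValue fun t ht t' ht' => ?_⟩
    · refine mem_fiber.mpr (hΩ _ (mem_fiber.mp hx) _ (Fin.cases ?_ fun i => ?_))
      · simpa using hb
      · simp
    · rw [mem_heavyTails] at ht ⊢
      refine ht.trans_le (Finset.card_le_card fun x hx => ?_)
      refine mem_fiber.mpr (hΩ _ (mem_fiber.mp hx) _ (Fin.cases ?_ fun i => ?_))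
      · simp
      · simpa using ht' i

/-! ### The functionals as tensor products -/

lemma evalAt_eq_prodFunctional {d : ℕ} (h : ℝ) (ω : Fin d → ℝ × ℕ) :
    evalAt (fun i => (ω i).1 + h * ((ω i).2 : ℝ)) = prodFunctional (shiftValue h) ω := by
  refine eq_prodFunctional _ fun a => ?_
  rw [evalAt, AlgHom.toLinearMap_apply, MvPolynomial.aeval_monomial, map_one, one_mul,
    Finsupp.prod_fintype _ _ (by simp)]
  rfl

lemma pderiv_pow_monomial {d : ℕ} (i : Fin d) (k : ℕ) (n : Fin d →₀ ℕ) (r : ℝ) :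
    (((MvPolynomial.pderiv i : Derivation ℝ (MvPolynomial (Fin d) ℝ) _).toLinearMap :
      Module.End ℝ (MvPolynomial (Fin d) ℝ)) ^ k) (MvPolynomial.monomial n r) =
      MvPolynomial.monomial (n - Finsupp.single i k) (r * ((n i).descFactorial k : ℝ)) := by
  induction k with
  | zero => simp
  | succ k ih =>
    rw [pow_succ', Module.End.mul_apply, ih]
    change MvPolynomial.pderiv i _ = _
    rw [MvPolynomial.pderiv_monomial, Finsupp.single_add, tsub_add_eq_tsub_tsub,
      Nat.descFactorial_succ]
    congr 1
    simp only [Finsupp.coe_tsub, Pi.sub_apply, Finsupp.single_eq_same, Nat.cast_mul]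
    ring

/-- The factors of `diffOp` act on distinct variables, so each one sees the original exponent. -/
lemma list_prod_pderiv_pow_monomial {d : ℕ} (α : Fin d → ℕ) (n : Fin d →₀ ℕ) (r : ℝ) :
    ∀ l : List (Fin d), l.Nodup →
    (l.map fun i => ((MvPolynomial.pderiv i : Derivation ℝ (MvPolynomial (Fin d) ℝ) _).toLinearMap :
      Module.End ℝ (MvPolynomial (Fin d) ℝ)) ^ α i).prod (MvPolynomial.monomial n r) =
      MvPolynomial.monomial (n - (l.map fun i => Finsupp.single i (α i)).sum)
        (r * (l.map fun i => ((n i).descFactorial (α i) : ℝ)).prod)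
  | [], _ => by simp
  | i :: l, hl => by
    rw [List.nodup_cons] at hl
    have h0 : (l.map fun j => Finsupp.single j (α j)).sum i = 0 := by
      have := hl.1
      clear hl
      induction l with
      | nil => simp
      | cons j l ih =>
        simp only [List.mem_cons, not_or] at this
        simp [ih this.2, Ne.symm this.1]
    simp only [List.map_cons, List.prod_cons, List.sum_cons, Module.End.mul_apply]
    rw [list_prod_pderiv_pow_monomial α n r l hl.2, pderiv_pow_monomial, add_comm,
      tsub_add_eq_tsub_tsub]
    congr 1
    rw [Finsupp.tsub_apply, h0, Nat.sub_zero]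
    ring

lemma evalAt_comp_diffOp_eq_prodFunctional {d : ℕ} (ω : Fin d → ℝ × ℕ) :
    evalAt (fun i => (ω i).1) ∘ₗ diffOp (fun i => (ω i).2) = prodFunctional derivValue ω := by
  refine eq_prodFunctional _ fun a => ?_
  rw [LinearMap.comp_apply, diffOp, List.ofFn_eq_map,
    list_prod_pderiv_pow_monomial _ _ _ _ (List.nodup_finRange d), ← List.ofFn_eq_map,
    ← List.ofFn_eq_map, List.sum_ofFn, List.prod_ofFn, evalAt, AlgHom.toLinearMap_apply,
    MvPolynomial.aeval_monomial, Finsupp.prod_fintype _ _ (by simp), one_mul]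
  simp only [Algebra.algebraMap_self, RingHom.id_apply]
  rw [← Finset.prod_mul_distrib]
  refine Finset.prod_congr rfl fun i _ => ?_
  rw [derivValue, Finsupp.tsub_apply, Finsupp.finsetSum_apply]
  simp [Finsupp.single_apply]

/-! ### The bound `η` -/

lemma minRatio_anti {L M : Set (ℝ × ℕ)} (h : L ⊆ M) : minRatio M ≤ minRatio L :=
  sInf_le_sInf fun _ ⟨p, hp, q, hq, hr⟩ => ⟨p, h hp, q, h hq, hr⟩

lemma minRatio_pos {L : Set (ℝ × ℕ)} (hL : L.Finite) : 0 < minRatio L := by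
  rw [minRatio]
  set R := {r : ℝ≥0∞ | ∃ p ∈ L, ∃ q ∈ L, p.1 ≠ q.1 ∧ p.2 ≠ q.2 ∧
    r = ENNReal.ofReal (|p.1 - q.1| / |(p.2 : ℝ) - (q.2 : ℝ)|)} with hR
  have hfin : R.Finite := by
    refine ((hL.prod hL).image fun x : (ℝ × ℕ) × ℝ × ℕ =>
      ENNReal.ofReal (|x.1.1 - x.2.1| / |(x.1.2 : ℝ) - (x.2.2 : ℝ)|)).subset ?_
    rintro r ⟨p, hp, q, hq, -, -, rfl⟩
    exact ⟨(p, q), ⟨hp, hq⟩, rfl⟩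
  rcases R.eq_empty_or_nonempty with h | h
  · rw [h, sInf_empty]
    exact ENNReal.zero_lt_top
  · obtain ⟨p, -, q, -, h1, h2, hr⟩ := h.csInf_mem hfin
    rw [hr, ENNReal.ofReal_pos]
    exact div_pos (abs_pos.mpr (sub_ne_zero.mpr h1))
      (abs_pos.mpr (sub_ne_zero.mpr (Nat.cast_injective.ne h2)))

/-- Below `minRatio L` no two labels of `L` have the same perturbed node. -/
lemma injOn_shiftNode {L : Set (ℝ × ℕ)} {h : ℝ} (h0 : h ≠ 0)
    (hL : ENNReal.ofReal |h| < minRatio L) : Set.InjOn (shiftNode h) L := by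
  intro p hp q hq hpq
  simp only [shiftNode] at hpq
  by_cases h2 : p.2 = q.2
  · refine Prod.ext ?_ h2
    rw [h2] at hpq
    exact add_right_cancel hpq
  have h2' : (p.2 : ℝ) - q.2 ≠ 0 := sub_ne_zero.mpr (Nat.cast_injective.ne h2)
  have hsub : p.1 - q.1 = -h * ((p.2 : ℝ) - q.2) := by linear_combination hpq
  have h1 : p.1 ≠ q.1 := by
    rw [← sub_ne_zero, hsub]
    exact mul_ne_zero (neg_ne_zero.mpr h0) h2'
  refine absurd hL (not_lt.mpr (sInf_le ⟨p, hp, q, hq, h1, h2, ?_⟩))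
  rw [hsub, abs_mul, abs_neg, mul_div_cancel_right₀ _ (abs_ne_zero.mpr h2')]

lemma etaFirst_le_minRatio (L : Set (ℝ × ℕ)) : etaFirst L ≤ minRatio L := by
  refine le_sInf ?_
  rintro r ⟨p, hp, q, hq, h1, h2, rfl⟩
  rw [etaFirst, if_neg, if_neg]
  · exact sInf_le ⟨p, hp, q, hq, h1, h2, rfl⟩
  · rintro (h | h)
    · exact h1 (h p hp q hq)
    · exact h2 (h p hp q hq)
  · intro h
    obtain ⟨x, rfl⟩ := Set.encard_eq_one.mp h
    rw [Set.mem_singleton_iff] at hp hq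
    exact h1 (by rw [hp, hq])

lemma minRatio_le_etaFirst {L M : Set (ℝ × ℕ)} (h : L ⊆ M) : minRatio M ≤ etaFirst L := by
  rw [etaFirst]
  split_ifs
  exacts [le_top, le_top, minRatio_anti h]

lemma childLabels_rootedTree_subset {A : Type*} {d : ℕ} (Ω : Set (Fin d → A)) (v : List A) :
    childLabels (rootedTree Ω) v ⊆ {x | ∃ ω ∈ Ω, ∃ i, ω i = x} := by
  rintro x ⟨ω, hω, hx⟩
  have : x ∈ (List.ofFn ω).reverse := hx.subset (by simp)
  rw [List.mem_reverse, List.mem_ofFn] at this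
  exact ⟨ω, hω, this⟩

variable {d μ : ℕ}

/-- The finite set underlying `algMultiset ξ Δ`. -/
noncomputable def labelVectors (ξ : Fin μ → Fin d → ℝ) (Δ : Fin μ → Finset (Fin d → ℕ)) :
    Finset (Fin d → ℝ × ℕ) :=
  Finset.univ.biUnion fun k => (Δ k).image fun α i => (ξ k i, α i)

lemma mem_labelVectors {ξ : Fin μ → Fin d → ℝ} {Δ : Fin μ → Finset (Fin d → ℕ)}
    {ω : Fin d → ℝ × ℕ} : ω ∈ labelVectors ξ Δ ↔ ∃ k, ∃ α ∈ Δ k, (fun i => (ξ k i, α i)) = ω := by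
  simp [labelVectors]

lemma mem_algMultiset {ξ : Fin μ → Fin d → ℝ} {Δ : Fin μ → Finset (Fin d → ℕ)}
    {ω : Fin d → ℝ × ℕ} : ω ∈ algMultiset ξ Δ ↔ ω ∈ labelVectors ξ Δ := by
  simp only [algMultiset, Set.mem_ofPred_eq, mem_labelVectors, eq_comm]

lemma eta_pos (ξ : Fin μ → Fin d → ℝ) (Δ : Fin μ → Finset (Fin d → ℕ)) : 0 < eta ξ Δ := by
  set M : Set (ℝ × ℕ) := {x | ∃ ω ∈ algMultiset ξ Δ, ∃ i, ω i = x} with hM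
  have hfin : M.Finite := by
    refine (((labelVectors ξ Δ) ×ˢ Finset.univ).image
      fun x : (Fin d → ℝ × ℕ) × Fin d => x.1 x.2).finite_toSet.subset ?_
    rintro x ⟨ω, hω, i, rfl⟩
    rw [Finset.coe_image]
    exact ⟨(ω, i), by simpa using mem_algMultiset.mp hω, rfl⟩
  refine (minRatio_pos hfin).trans_le (le_min ?_ ?_)
  · exact minRatio_le_etaFirst (childLabels_rootedTree_subset _ _)
  · exact le_iInf₂ fun _ _ => le_iInf₂ fun v _ =>
      minRatio_anti (childLabels_rootedTree_subset _ v)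

/-- For `0 < |h| < η` perturbing the labels separates the children of every node of the tree. -/
lemma eq_of_shiftNode_eq {ξ : Fin μ → Fin d → ℝ} {Δ : Fin μ → Finset (Fin d → ℕ)} {h : ℝ}
    (h0 : h ≠ 0) (hh : ENNReal.ofReal |h| < eta ξ Δ) {ω ω' : Fin d → ℝ × ℕ}
    (hω : ω ∈ algMultiset ξ Δ) (hω' : ω' ∈ algMultiset ξ Δ) {i : Fin d}
    (hi : ∀ j, i < j → ω j = ω' j) (hn : shiftNode h (ω i) = shiftNode h (ω' i)) :
    ω i = ω' i := by
  set T := rootedTree (algMultiset ξ Δ) with hT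
  -- The common parent of the two nodes, as the list of the labels with index above `i`.
  set v := ((List.ofFn ω).drop (i + 1)).reverse with hv
  have hv' : v = ((List.ofFn ω').drop (i + 1)).reverse := by
    rw [hv]
    congr 1
    refine List.ext_getElem (by simp) fun n h1 h2 => ?_
    simp only [List.getElem_drop, List.getElem_ofFn]
    exact hi _ (Fin.lt_def.mpr (by simp only; omega))
  have hpre : ∀ η : Fin d → ℝ × ℕ, ((List.ofFn η).drop (i + 1)).reverse ++ [η i] <+:
      (List.ofFn η).reverse := by
    intro η
    have : (List.ofFn η).drop i = η i :: (List.ofFn η).drop (i + 1) := by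
      rw [List.drop_eq_getElem_cons (by simp)]
      simp
    rw [← List.reverse_cons, ← this, List.reverse_prefix]
    exact List.drop_suffix _ _
  have hmem : ω i ∈ childLabels T v := ⟨ω, hω, hpre ω⟩
  have hmem' : ω' i ∈ childLabels T v := ⟨ω', hω', by rw [hv']; exact hpre ω'⟩
  have hlen : v.length + 1 + i = d := by
    have := i.isLt
    simp only [hv, List.length_reverse, List.length_drop, List.length_ofFn]
    omega
  by_contra hne
  refine hne (injOn_shiftNode h0 (hh.trans_le ?_) hmem hmem' hn)
  rcases Nat.eq_zero_or_pos v.length with hv0 | hv0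
  · rw [List.length_eq_zero_iff.mp hv0]
    exact (min_le_left _ _).trans (etaFirst_le_minRatio _)
  · refine (min_le_right _ _).trans ((iInf₂_le (v.length + 1) ?_).trans (iInf₂_le v ?_))
    · rw [Finset.mem_Icc]
      omega
    · refine ⟨⟨ω, hω, (List.prefix_append _ _).trans (hpre ω)⟩, rfl, ?_⟩
      rw [← Set.encard_pair hne]
      exact Set.encard_le_encard (Set.insert_subset hmem (Set.singleton_subset_iff.mpr hmem'))

/-! ### Divided differences -/

/-- The coefficient of the evaluation at `s + b h` in the divided difference of order `a` with base
point `s` and step `h`. -/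
noncomputable def diffCoeff (h : ℝ) (a b : ℕ) : ℝ := (h ^ a)⁻¹ * ((-1) ^ (a - b) * a.choose b)

/-- The value at `X ^ n` of the divided difference that approximates the functional `p ↦ p⁽ᵃ⁾(s)`
attached to the label `(s, a)`. -/
noncomputable def diffValue (h : ℝ) (x : ℝ × ℕ) (n : ℕ) : ℝ :=
  ∑ b ∈ Finset.range (x.2 + 1), diffCoeff h x.2 b * shiftValue h (x.1, b) n

lemma sum_choose_mul_pow_of_lt {a j : ℕ} (h : j < a) :
    ∑ b ∈ Finset.range (a + 1), ((-1) ^ (a - b) * a.choose b : ℝ) * (b : ℝ) ^ j = 0 := by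
  have := congrFun (fwdDiff_iter_pow_eq_zero_of_lt (R := ℝ) h) 0
  rw [fwdDiff_iter_eq_sum_shift] at this
  simpa using this

lemma sum_choose_mul_pow_self (a : ℕ) :
    ∑ b ∈ Finset.range (a + 1), ((-1) ^ (a - b) * a.choose b : ℝ) * (b : ℝ) ^ a
      = a.factorial := by
  have := congrFun (fwdDiff_iter_eq_factorial (R := ℝ) (n := a)) 0
  rw [fwdDiff_iter_eq_sum_shift] at this
  simpa using this

/-- Expanding the powers of `s + b h` cancels the factor `h⁻ᵃ`: the terms of order less than `a`
in `h` vanish since `a`-th differences annihilate polynomials of degree less than `a`. (For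
`j < x.2` the truncated exponent `j - x.2` is immaterial, as the inner sum is then zero.) -/
lemma diffValue_eq {h : ℝ} (h0 : h ≠ 0) (x : ℝ × ℕ) (n : ℕ) :
    diffValue h x n = ∑ j ∈ Finset.range (n + 1), h ^ (j - x.2) * (x.1 ^ (n - j) * n.choose j) *
      ∑ b ∈ Finset.range (x.2 + 1), ((-1) ^ (x.2 - b) * x.2.choose b : ℝ) * (b : ℝ) ^ j := by
  obtain ⟨s, a⟩ := x
  simp only [diffValue, diffCoeff, shiftValue, shiftNode]
  have : ∀ b : ℕ, (s + h * b) ^ n =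
      ∑ j ∈ Finset.range (n + 1), (h * b) ^ j * s ^ (n - j) * n.choose j := fun b => by
    rw [add_comm, add_pow]
  simp only [this, Finset.mul_sum]
  rw [Finset.sum_comm]
  refine Finset.sum_congr rfl fun j _ => ?_
  rcases lt_or_ge j a with hj | hj
  · trans (h ^ a)⁻¹ * (h ^ j * (s ^ (n - j) * n.choose j)) *
      ∑ b ∈ Finset.range (a + 1), ((-1) ^ (a - b) * a.choose b : ℝ) * (b : ℝ) ^ j
    · rw [Finset.mul_sum]
      exact Finset.sum_congr rfl fun b _ => by ring
    · rw [← Finset.mul_sum, sum_choose_mul_pow_of_lt hj, mul_zero, mul_zero]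
  · refine Finset.sum_congr rfl fun b _ => ?_
    obtain ⟨k, rfl⟩ := Nat.exists_eq_add_of_le hj
    rw [Nat.add_sub_cancel_left, mul_pow, pow_add]
    field_simp

lemma tendsto_diffValue (x : ℝ × ℕ) (n : ℕ) :
    Filter.Tendsto (fun h => diffValue h x n) (𝓝[≠] 0) (𝓝 (derivValue x n)) := by
  set g : ℝ → ℝ := fun h =>
    ∑ j ∈ Finset.range (n + 1), h ^ (j - x.2) * (x.1 ^ (n - j) * n.choose j) *
      ∑ b ∈ Finset.range (x.2 + 1), ((-1) ^ (x.2 - b) * x.2.choose b : ℝ) * (b : ℝ) ^ j with hg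
  have hcont : Continuous g := by fun_prop
  have hg0 : g 0 = derivValue x n := by
    simp only [hg]
    rw [Finset.sum_eq_single x.2]
    · rw [sum_choose_mul_pow_self, derivValue, Nat.descFactorial_eq_factorial_mul_choose,
        Nat.sub_self, pow_zero]
      push_cast
      ring
    · intro j _ hj
      rcases hj.lt_or_gt with hj | hj
      · rw [sum_choose_mul_pow_of_lt hj, mul_zero]
      · rw [zero_pow (Nat.sub_ne_zero_of_lt hj), zero_mul, zero_mul]
    · intro hj
      rw [Nat.choose_eq_zero_of_lt (by simpa [Nat.lt_succ_iff] using hj)]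
      simp
  rw [← hg0]
  refine ((hcont.tendsto 0).mono_left nhdsWithin_le_nhds).congr' ?_
  filter_upwards [self_mem_nhdsWithin] with h h0
  exact (diffValue_eq h0 x n).symm

lemma prodFunctional_diffValue (h : ℝ) (ω : Fin d → ℝ × ℕ) :
    prodFunctional (diffValue h) ω =
      ∑ β ∈ Fintype.piFinset fun i => Finset.range ((ω i).2 + 1),
        (∏ i, diffCoeff h (ω i).2 (β i)) •
          prodFunctional (shiftValue h) fun i => ((ω i).1, β i) := by
  refine (eq_prodFunctional _ fun a => ?_).symm
  simp only [diffValue]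
  rw [Finset.prod_univ_sum, LinearMap.sum_apply]
  refine Finset.sum_congr rfl fun β _ => ?_
  rw [LinearMap.smul_apply, prodFunctional_monomial, one_mul, smul_eq_mul,
    Finset.prod_mul_distrib]

lemma tendsto_prodFunctional_diffValue (ω : Fin d → ℝ × ℕ) (f : MvPolynomial (Fin d) ℝ) :
    Filter.Tendsto (fun h => prodFunctional (diffValue h) ω f) (𝓝[≠] 0)
      (𝓝 (prodFunctional derivValue ω f)) := by
  simp only [prodFunctional_apply]
  exact tendsto_finsetSum _ fun a _ => Filter.Tendsto.const_mul _
    (tendsto_finsetProd _ fun i _ => tendsto_diffValue _ _)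

/-! ### Limits of solutions of linear systems -/

open Matrix in
/-- Solutions of convergent linear systems converge when the limit matrix has trivial kernel. -/
lemma tendsto_of_mulVec_eq {ι m n : Type*} [Fintype m] [Fintype n] [DecidableEq m] [DecidableEq n]
    {l : Filter ι} {A : ι → Matrix m n ℝ} {A₀ : Matrix m n ℝ} {x : ι → n → ℝ} {x₀ : n → ℝ}
    {b : ι → m → ℝ} (hA : Filter.Tendsto A l (𝓝 A₀)) (hinj : ∀ v, A₀ *ᵥ v = 0 → v = 0)
    (hb : Filter.Tendsto b l (𝓝 (A₀ *ᵥ x₀))) (hx : ∀ᶠ t in l, A t *ᵥ x t = b t) :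
    Filter.Tendsto x l (𝓝 x₀) := by
  -- A left inverse `B` of `A₀` makes the system square: `B * A t` tends to the identity matrix.
  obtain ⟨g, hg⟩ := A₀.mulVecLin.exists_leftInverse_of_injective
    (LinearMap.ker_eq_bot'.mpr hinj)
  set B := LinearMap.toMatrix' g with hB
  have hBA : B * A₀ = 1 := by
    rw [hB, ← LinearMap.toMatrix'_toLin' A₀, ← LinearMap.toMatrix'_comp, Matrix.toLin'_apply', hg,
      LinearMap.toMatrix'_id]
  have hM : Filter.Tendsto (fun t => B * A t) l (𝓝 1) := by
    rw [← hBA]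
    exact ((continuous_const.matrix_mul continuous_id).tendsto A₀).comp hA
  have hdet : Filter.Tendsto (fun t => (B * A t).det) l (𝓝 1) := by
    have := ((continuous_id.matrix_det (n := n) (R := ℝ)).tendsto 1).comp hM
    simpa [Function.comp_def] using this
  have hadj : Filter.Tendsto (fun t => (B * A t).adjugate) l (𝓝 1) := by
    have := ((continuous_id.matrix_adjugate (n := n) (R := ℝ)).tendsto 1).comp hM
    simpa [Function.comp_def] using this
  have hBb : Filter.Tendsto (fun t => B *ᵥ b t) l (𝓝 x₀) := by
    have := ((continuous_const (y := B)).matrix_mulVec continuous_id).tendsto (A₀ *ᵥ x₀)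
    have := this.comp hb
    simpa [Function.comp_def, Matrix.mulVec_mulVec, hBA] using this
  have hlim : Filter.Tendsto (fun t => ((B * A t).det)⁻¹ • ((B * A t).adjugate *ᵥ (B *ᵥ b t))) l
      (𝓝 x₀) := by
    have h1 := ((continuous_fst.matrix_mulVec continuous_snd).tendsto
      ((1 : Matrix n n ℝ), x₀)).comp (hadj.prodMk_nhds hBb)
    have h2 := (hdet.inv₀ one_ne_zero).smul h1
    simpa using h2
  refine hlim.congr' ?_
  filter_upwards [hx, hdet.eventually_ne one_ne_zero] with t ht hne
  rw [← ht, Matrix.mulVec_mulVec (x t) B, Matrix.mulVec_mulVec, Matrix.adjugate_mul,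
    Matrix.smul_mulVec, Matrix.one_mulVec, inv_smul_smul₀ hne]

/-! ### Ideal projectors -/

lemma mem_ker_iff_of_ranDual_eq {P : PolyOp d}
    {S : Set (Module.Dual ℝ (MvPolynomial (Fin d) ℝ))} (hS : ranDual P = Submodule.span ℝ S)
    (f : MvPolynomial (Fin d) ℝ) : f ∈ LinearMap.ker P ↔ ∀ l ∈ S, l f = 0 := by
  constructor
  · intro hf l hl
    obtain ⟨φ, rfl⟩ : l ∈ ranDual P := hS ▸ Submodule.subset_span hl
    rw [LinearMap.dualMap_apply, LinearMap.mem_ker.mp hf, map_zero]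
  · intro hf
    rw [LinearMap.mem_ker, ← Module.forall_dual_apply_eq_zero_iff ℝ]
    intro φ
    have hφ : P.dualMap φ ∈ Submodule.span ℝ S := hS ▸ LinearMap.mem_range_self _ φ
    have hle : Submodule.span ℝ S ≤ LinearMap.ker (Module.Dual.eval ℝ _ f) :=
      Submodule.span_le.mpr hf
    exact hle hφ

lemma IsPartialDerivativeType.mem_ker_iff {ξ : Fin μ → Fin d → ℝ}
    {Δ : Fin μ → Finset (Fin d → ℕ)} {P : PolyOp d} (hP : IsPartialDerivativeType ξ Δ P)
    (f : MvPolynomial (Fin d) ℝ) :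
    f ∈ LinearMap.ker P ↔ ∀ ω ∈ labelVectors ξ Δ, prodFunctional derivValue ω f = 0 := by
  rw [mem_ker_iff_of_ranDual_eq hP.ranDual_eq]
  constructor
  · intro h ω hω
    obtain ⟨k, α, hα, rfl⟩ := mem_labelVectors.mp hω
    rw [← evalAt_comp_diffOp_eq_prodFunctional]
    exact h _ ⟨k, α, hα, rfl⟩
  · rintro h _ ⟨k, α, hα, rfl⟩
    have := h _ (mem_labelVectors.mpr ⟨k, α, hα, rfl⟩)
    rwa [← evalAt_comp_diffOp_eq_prodFunctional] at this

lemma IsPerturbedLagrange.mem_ker_iff {ξ : Fin μ → Fin d → ℝ}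
    {Δ : Fin μ → Finset (Fin d → ℕ)} {h : ℝ} {Q : PolyOp d} (hQ : IsPerturbedLagrange ξ Δ h Q)
    (f : MvPolynomial (Fin d) ℝ) :
    f ∈ LinearMap.ker Q ↔ ∀ ω ∈ labelVectors ξ Δ, prodFunctional (shiftValue h) ω f = 0 := by
  rw [mem_ker_iff_of_ranDual_eq hQ.ranDual_eq]
  constructor
  · intro hf ω hω
    obtain ⟨k, α, hα, rfl⟩ := mem_labelVectors.mp hω
    rw [← evalAt_eq_prodFunctional]
    exact hf _ ⟨k, α, hα, rfl⟩
  · rintro hf _ ⟨k, α, hα, rfl⟩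
    have := hf _ (mem_labelVectors.mpr ⟨k, α, hα, rfl⟩)
    rwa [← evalAt_eq_prodFunctional] at this

lemma IsIdealProjector.lexEscalier_eq {P : PolyOp d} (hP : IsIdealProjector P)
    {A : Type*} [DecidableEq A] {c : A → ℕ → ℝ} {Ω : Finset (Fin d → A)}
    (hΩ : FiberUnisolvent c Ω)
    (hker : ∀ f, f ∈ LinearMap.ker P ↔ ∀ ω ∈ Ω, prodFunctional c ω f = 0) :
    lexEscalier (LinearMap.ker P : Set (MvPolynomial (Fin d) ℝ)) = lexExponents Ω := by
  obtain ⟨I, hI⟩ := hP.ker_ideal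
  rw [hI] at hker ⊢
  exact lexEscalier_eq_lexExponents c hΩ hker

lemma labelVectors_lower {ξ : Fin μ → Fin d → ℝ} {Δ : Fin μ → Finset (Fin d → ℕ)}
    (hΔ : ∀ k, IsLower (Δ k)) {ω : Fin d → ℝ × ℕ} (hω : ω ∈ labelVectors ξ Δ)
    {ω' : Fin d → ℝ × ℕ} (h : ∀ i, (ω' i).1 = (ω i).1 ∧ (ω' i).2 ≤ (ω i).2) :
    ω' ∈ labelVectors ξ Δ := by
  obtain ⟨k, α, hα, rfl⟩ := mem_labelVectors.mp hω
  refine mem_labelVectors.mpr ⟨k, fun i => (ω' i).2, (hΔ k).2 (fun i => (h i).2) hα, ?_⟩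
  funext i
  exact Prod.ext (h i).1.symm rfl

lemma IsPartialDerivativeType.lexEscalier_eq {ξ : Fin μ → Fin d → ℝ}
    {Δ : Fin μ → Finset (Fin d → ℕ)} (hΔ : ∀ k, IsLower (Δ k)) {P : PolyOp d}
    (hP : IsPartialDerivativeType ξ Δ P) :
    lexEscalier (LinearMap.ker P : Set (MvPolynomial (Fin d) ℝ)) =
      lexExponents (labelVectors ξ Δ) :=
  hP.isIdealProjector.lexEscalier_eq
    (fiberUnisolvent_derivValue fun _ hω _ h => labelVectors_lower hΔ hω h) hP.mem_ker_iff

lemma IsPerturbedLagrange.lexEscalier_eq {ξ : Fin μ → Fin d → ℝ}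
    {Δ : Fin μ → Finset (Fin d → ℕ)} {h : ℝ} (h0 : h ≠ 0) (hh : ENNReal.ofReal |h| < eta ξ Δ)
    {Q : PolyOp d} (hQ : IsPerturbedLagrange ξ Δ h Q) :
    lexEscalier (LinearMap.ker Q : Set (MvPolynomial (Fin d) ℝ)) =
      lexExponents (labelVectors ξ Δ) :=
  hQ.isLagrangeProjector.isIdealProjector.lexEscalier_eq
    (fiberUnisolvent_shiftValue fun _ hω _ hω' _ hi hn =>
      eq_of_shiftNode_eq h0 hh (mem_algMultiset.mpr hω) (mem_algMultiset.mpr hω') hi hn)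
    hQ.mem_ker_iff

lemma coeff_eq_zero_of_mem_span_monomials {s : Set (Fin d →₀ ℕ)} {f : MvPolynomial (Fin d) ℝ}
    (hf : f ∈ Submodule.span ℝ ((fun a => MvPolynomial.monomial a (1 : ℝ)) '' s))
    {a : Fin d →₀ ℕ} (ha : a ∉ s) : f.coeff a = 0 := by
  have hle : Submodule.span ℝ ((fun a => MvPolynomial.monomial a (1 : ℝ)) '' s) ≤
      LinearMap.ker (MvPolynomial.lcoeff ℝ a) := by
    rw [Submodule.span_le]
    rintro _ ⟨b, hb, rfl⟩
    have : b ≠ a := fun h => ha (h ▸ hb)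
    simp [MvPolynomial.coeff_monomial, this]
  exact hle hf

lemma prodFunctional_apply_of_mem_span {A : Type*} (c : A → ℕ → ℝ) {E : Finset (Fin d →₀ ℕ)}
    {f : MvPolynomial (Fin d) ℝ}
    (hf : f ∈ Submodule.span ℝ ((fun a => MvPolynomial.monomial a (1 : ℝ)) '' (E : Set _)))
    (ω : Fin d → A) :
    prodFunctional c ω f = ∑ a : E, (∏ i, c (ω i) (a.1 i)) * f.coeff a.1 := by
  rw [prodFunctional_apply, Finset.sum_coe_sort E fun a => (∏ i, c (ω i) (a i)) * f.coeff a]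
  simp only [mul_comm (MvPolynomial.coeff _ f)]
  refine Finset.sum_subset (fun a ha => ?_) fun a _ ha => ?_
  · by_contra h
    exact MvPolynomial.mem_support_iff.mp ha (coeff_eq_zero_of_mem_span_monomials hf h)
  · rw [MvPolynomial.notMem_support_iff.mp ha, mul_zero]

lemma IsIdealProjector.sub_apply_mem_ker {P : PolyOp d} (hP : IsIdealProjector P)
    (q : MvPolynomial (Fin d) ℝ) : P q - q ∈ LinearMap.ker P := by
  rw [LinearMap.mem_ker, map_sub, sub_eq_zero]
  exact LinearMap.congr_fun hP.idem q

lemma IsIdealProjector.eq_zero_of_mem_range_of_mem_ker {P : PolyOp d} (hP : IsIdealProjector P)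
    {f : MvPolynomial (Fin d) ℝ} (hf : f ∈ LinearMap.range P) (hf' : f ∈ LinearMap.ker P) :
    f = 0 := by
  obtain ⟨g, rfl⟩ := hf
  exact (LinearMap.congr_fun hP.idem g).symm.trans hf'

/-- The divided differences at the nodes vanish on the kernel of the perturbed projector; this
uses that every node entering a divided difference belongs to the same lower set. -/
lemma IsPerturbedLagrange.prodFunctional_diffValue_eq_zero {ξ : Fin μ → Fin d → ℝ}
    {Δ : Fin μ → Finset (Fin d → ℕ)} (hΔ : ∀ k, IsLower (Δ k)) {h : ℝ} {Q : PolyOp d}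
    (hQ : IsPerturbedLagrange ξ Δ h Q) {f : MvPolynomial (Fin d) ℝ} (hf : f ∈ LinearMap.ker Q)
    {ω : Fin d → ℝ × ℕ} (hω : ω ∈ labelVectors ξ Δ) : prodFunctional (diffValue h) ω f = 0 := by
  rw [prodFunctional_diffValue, LinearMap.sum_apply]
  refine Finset.sum_eq_zero fun β hβ => ?_
  rw [LinearMap.smul_apply, (hQ.mem_ker_iff f).mp hf _ (labelVectors_lower hΔ hω fun i => ?_),
    smul_zero]
  exact ⟨rfl, Nat.lt_succ_iff.mp (Finset.mem_range.mp (Fintype.mem_piFinset.mp hβ i))⟩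

end IdealProj

theorem mainTheorem4 (d μ : ℕ) (hμ : 0 < μ)
    (ξ : Fin μ → Fin d → ℝ) (hξ : Function.Injective ξ)
    (Δ : Fin μ → Finset (Fin d → ℕ)) (hΔ : ∀ k, IdealProj.IsLower (Δ k))
    (P : IdealProj.PolyOp d) (hP : IdealProj.IsPartialDerivativeType ξ Δ P)
    (hPran : LinearMap.range P = IdealProj.lexRange P)
    (Ph : ℝ → IdealProj.PolyOp d)
    (hPh : ∀ h : ℝ, 0 < |h| → ENNReal.ofReal |h| < IdealProj.eta ξ Δ →
      IdealProj.IsPerturbedLagrange ξ Δ h (Ph h) ∧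
        LinearMap.range (Ph h) = IdealProj.lexRange (Ph h)) :
    0 < IdealProj.eta ξ Δ ∧
    (∀ h : ℝ, 0 < |h| → ENNReal.ofReal |h| < IdealProj.eta ξ Δ →
      LinearMap.range (Ph h) = LinearMap.range P) ∧
    (∀ (q : MvPolynomial (Fin d) ℝ) (a : Fin d →₀ ℕ),
      Filter.Tendsto (fun h : ℝ => MvPolynomial.coeff a (Ph h q)) (𝓝[≠] 0)
        (𝓝 (MvPolynomial.coeff a (P q)))) := by
  open IdealProj in
  have hη : 0 < eta ξ Δ := eta_pos ξ Δ
  set Ω := labelVectors ξ Δ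
  set E := lexExponents Ω
  have hrangeP : LinearMap.range P =
      Submodule.span ℝ ((fun a => MvPolynomial.monomial a (1 : ℝ)) '' (E : Set _)) := by
    rw [hPran, lexRange, hP.lexEscalier_eq hΔ]
  have hrange : ∀ h : ℝ, 0 < |h| → ENNReal.ofReal |h| < eta ξ Δ → LinearMap.range (Ph h) =
      Submodule.span ℝ ((fun a => MvPolynomial.monomial a (1 : ℝ)) '' (E : Set _)) := by
    intro h h0 hh
    rw [(hPh h h0 hh).2, lexRange, (hPh h h0 hh).1.lexEscalier_eq (abs_pos.mp h0) hh]
  refine ⟨hη, fun h h0 hh => (hrange h h0 hh).trans hrangeP.symm, fun q a => ?_⟩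
  have hev : ∀ᶠ h : ℝ in 𝓝[≠] 0, 0 < |h| ∧ ENNReal.ofReal |h| < eta ξ Δ := by
    have hcont : Filter.Tendsto (fun h : ℝ => ENNReal.ofReal |h|) (𝓝 0) (𝓝 0) := by
      have := (ENNReal.continuous_ofReal.comp continuous_abs).tendsto (0 : ℝ)
      simpa [Function.comp_def] using this
    filter_upwards [self_mem_nhdsWithin,
      nhdsWithin_le_nhds (hcont.eventually_lt_const hη)] with h h0 hh
    exact ⟨abs_pos.mpr h0, hh⟩
  have hPq : P q ∈ Submodule.span ℝ
      ((fun a => MvPolynomial.monomial a (1 : ℝ)) '' (E : Set _)) :=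
    hrangeP ▸ LinearMap.mem_range_self P q
  by_cases ha : a ∈ E
  · -- The coefficients of `P_h q` solve the collocation system of the divided differences.
    suffices H : Filter.Tendsto (fun h (b : E) => MvPolynomial.coeff b.1 (Ph h q)) (𝓝[≠] 0)
        (𝓝 fun b : E => MvPolynomial.coeff b.1 (P q)) from
      (tendsto_pi_nhds.mp H) ⟨a, ha⟩
    refine tendsto_of_mulVec_eq
      (A := fun h => Matrix.of fun (ω : Ω) (b : E) => ∏ i, diffValue h (ω.1 i) (b.1 i))
      (A₀ := Matrix.of fun (ω : Ω) (b : E) => ∏ i, derivValue (ω.1 i) (b.1 i))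
      (b := fun h (ω : Ω) => prodFunctional (diffValue h) ω.1 q) ?_ (fun v hv => ?_) ?_ ?_
    · refine tendsto_pi_nhds.mpr fun ω => tendsto_pi_nhds.mpr fun b => ?_
      simp only [Matrix.of_apply]
      exact tendsto_finsetProd _ fun i _ => tendsto_diffValue (ω.1 i) (b.1 i)
    · set f : MvPolynomial (Fin d) ℝ := ∑ b : E, v b • MvPolynomial.monomial b.1 1 with hf
      have hmem : f ∈ LinearMap.range P := by
        rw [hrangeP]
        exact Submodule.sum_mem _ fun b _ => Submodule.smul_mem _ _
          (Submodule.subset_span ⟨b.1, b.2, rfl⟩)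
      have hcoeff : ∀ b : E, f.coeff b.1 = v b := by
        intro b
        rw [hf, MvPolynomial.coeff_sum, Finset.sum_eq_single b]
        · simp
        · intro b' _ hb
          simp [MvPolynomial.coeff_monomial, Subtype.coe_injective.ne hb]
        · simp
      have hker : f ∈ LinearMap.ker P := by
        rw [hP.mem_ker_iff]
        intro ω hω
        rw [prodFunctional_apply_of_mem_span _ (hrangeP ▸ hmem)]
        simp only [hcoeff]
        exact congrFun hv ⟨ω, hω⟩
      have hf0 := hP.isIdealProjector.eq_zero_of_mem_range_of_mem_ker hmem hker
      funext b
      rw [← hcoeff b, hf0, MvPolynomial.coeff_zero, Pi.zero_apply]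
    · refine tendsto_pi_nhds.mpr fun ω => ?_
      have h1 := (hP.mem_ker_iff _).mp (hP.isIdealProjector.sub_apply_mem_ker q) ω.1 ω.2
      rw [map_sub, sub_eq_zero, prodFunctional_apply_of_mem_span _ hPq] at h1
      have h2 := tendsto_prodFunctional_diffValue ω.1 q
      rw [← h1] at h2
      exact h2
    · filter_upwards [hev] with h ⟨h0, hh⟩
      have hQ := (hPh h h0 hh).1
      funext ω
      have h1 := hQ.prodFunctional_diffValue_eq_zero hΔ
        (hQ.isLagrangeProjector.isIdealProjector.sub_apply_mem_ker q) ω.2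
      rw [map_sub, sub_eq_zero, prodFunctional_apply_of_mem_span (E := E) _
        (hrange h h0 hh ▸ LinearMap.mem_range_self _ q)] at h1
      exact h1
  · rw [coeff_eq_zero_of_mem_span_monomials hPq ha]
    refine tendsto_const_nhds.congr' ?_
    filter_upwards [hev] with h ⟨h0, hh⟩
    exact (coeff_eq_zero_of_mem_span_monomials
      (hrange h h0 hh ▸ LinearMap.mem_range_self _ q) ha).symm
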